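/- Let $H_B$ be a complex Hilbert space and let $L_B$ be a self-adjoint (possibly unbounded) operator on $H_B$ with $L_B\ge \ell_B I$ in the sense of quadratic forms, for some $\ell_B>0$. Let $m\ge 1$ be an integer and let $s>m/2$ be real. On the Hilbert space tensor product $H_M=H_B\otimes L^2(\mathbb{R}^m)$ (complex $L^2$, Lebesgue measure) let $$L_M = L_B\otimes I + I\otimes(-\Delta_y),$$ that is, the closure of this operator defined on the algebraic tensor product of the domains of $L_B$ and of $-\Delta_y$, where $-\Delta_y$ is the non-negative Euclidean Laplacian with domain $H^2(\mathbb{R}^m)$. Then $L_M$ is self-adjoint with $L_M\ge\ell_B I$. Negative fractional powers of self-adjoint operators with a positive lower bound are understood by the spectral theorem. The integral $$T_{m,s}(L_B)=\int_{\mathbb{R}^m}\frac{d^mq}{(2\pi)^m}\,(L_B+|q|^2)^{-s}$$ converges as a Bochner integral in operator norm. Moreover, let $\eta\in C_c^\infty(\mathbb{R}^m)$ be any (real- or complex-valued) function with $\int_{\mathbb{R}^m}\eta(y)\,dy=1$, and put $\eta_\varepsilon(y)=\varepsilon^{-m}\eta(y/\varepsilon)$ for $\varepsilon>0$. Then for all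 $J,K\in H_B$, $$\lim_{\varepsilon\to0^+}\big\langle J\otimes\eta_\varepsilon,\ L_M^{-s}\,(K\otimes\eta_\varepsilon)\big\rangle_{H_M}=\big\langle J,\ T_{m,s}(L_B)\,K\big\rangle_{H_B}.$$ In particular the limit does not depend on the choice of $\eta$. -/

import Mathlib

open MeasureTheory Filter Topology
open scoped TensorProduct ContDiff Laplacian SchwartzMap

noncomputable section

namespace TransverseRestriction

/-- The lower bound `L ≥ ℓ I` in the sense of quadratic forms. -/
def BoundedBelowBy {H : Type*} [NormedAddCommGroup H] [InnerProductSpace ℂ H]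
    (L : H →ₗ.[ℂ] H) (l : ℝ) : Prop :=
  ∀ x : L.domain, l * ‖(x : H)‖ ^ 2 ≤ (inner ℂ (x : H) (L x)).re

/-- `R` is the bounded, everywhere defined inverse of the unbounded operator `L`: it maps the
whole space into the domain of `L`, and is a two-sided inverse of `L`. -/
def IsBoundedInverse {H : Type*} [NormedAddCommGroup H] [InnerProductSpace ℂ H]
    (L : H →ₗ.[ℂ] H) (R : H →L[ℂ] H) : Prop :=
  (∀ x : L.domain, R (L x) = x) ∧ (∀ y : H, ∃ x : L.domain, (x : H) = R y ∧ L x = y)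

/-- A bounded inverse is unique. -/
theorem IsBoundedInverse.unique {H : Type*} [NormedAddCommGroup H] [InnerProductSpace ℂ H]
    {L : H →ₗ.[ℂ] H} {R S : H →L[ℂ] H}
    (hR : IsBoundedInverse L R) (hS : IsBoundedInverse L S) : R = S := by
  ext y
  obtain ⟨x, hx, rfl⟩ := hR.2 y
  rw [← hx, hS.1 x]

open Classical in
/-- The bounded inverse `L⁻¹` of an unbounded operator (zero if there is none). -/
def boundedInverse {H : Type*} [NormedAddCommGroup H] [InnerProductSpace ℂ H]
    (L : H →ₗ.[ℂ] H) : H →L[ℂ] H :=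
  if h : ∃ R : H →L[ℂ] H, IsBoundedInverse L R then h.choose else 0

theorem boundedInverse_eq {H : Type*} [NormedAddCommGroup H] [InnerProductSpace ℂ H]
    {L : H →ₗ.[ℂ] H} {R : H →L[ℂ] H} (hR : IsBoundedInverse L R) : boundedInverse L = R := by
  have h : ∃ R : H →L[ℂ] H, IsBoundedInverse L R := ⟨R, hR⟩
  rw [boundedInverse, dif_pos h]
  exact h.choose_spec.unique hR

/-- The negative fractional power `L ^ (-s)`, `s > 0`, of a self-adjoint operator `L ≥ ℓ I` with
`ℓ > 0`: the function `t ↦ t ^ s` of the bounded self-adjoint operator `L⁻¹`, in the sense of the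
functional calculus of `L⁻¹`. Under the spectral theorem, where `L⁻¹` is multiplication by `1 / λ`,
this is multiplication by `λ ^ (-s)`. -/
def negPow {H : Type*} [NormedAddCommGroup H] [InnerProductSpace ℂ H] [CompleteSpace H]
    (L : H →ₗ.[ℂ] H) (s : ℝ) : H →L[ℂ] H :=
  cfc (fun t : ℝ => t ^ s) (boundedInverse L)

/-- The operator `L + c I`, on the domain of `L`. -/
def shift {H : Type*} [NormedAddCommGroup H] [InnerProductSpace ℂ H]
    (L : H →ₗ.[ℂ] H) (c : ℝ) : H →ₗ.[ℂ] H :=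
  ((c : ℂ) • (LinearMap.id : H →ₗ[ℂ] H)) +ᵥ L

theorem shift_apply {H : Type*} [NormedAddCommGroup H] [InnerProductSpace ℂ H]
    (L : H →ₗ.[ℂ] H) (c : ℝ) (x : L.domain) :
    shift L c x = (c : ℂ) • (x : H) + L x :=
  rfl

/-- The Hilbert space tensor product: the completion of the algebraic tensor product with respect
to the inner product determined by `⟨a ⊗ f, b ⊗ g⟩ = ⟨a, b⟩ ⟨f, g⟩`. -/
abbrev HilbertTensor (E F : Type*) [NormedAddCommGroup E] [InnerProductSpace ℂ E]
    [NormedAddCommGroup F] [InnerProductSpace ℂ F] : Type _ :=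
  UniformSpace.Completion (E ⊗[ℂ] F)

/-- The pure tensor `a ⊗ f` in the Hilbert space tensor product. -/
def pureTensor {E F : Type*} [NormedAddCommGroup E] [InnerProductSpace ℂ E]
    [NormedAddCommGroup F] [InnerProductSpace ℂ F] (a : E) (f : F) : HilbertTensor E F :=
  ((a ⊗ₜ[ℂ] f : E ⊗[ℂ] F) : UniformSpace.Completion (E ⊗[ℂ] F))

/-- The graph of the operator `A ⊗ I + I ⊗ B` on the algebraic tensor product of the domains of
`A` and `B`: the span of the pairs `(u ⊗ v, A u ⊗ v + u ⊗ B v)`. -/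
def algTensorSumGraph {E F : Type*} [NormedAddCommGroup E] [InnerProductSpace ℂ E]
    [NormedAddCommGroup F] [InnerProductSpace ℂ F] (A : E →ₗ.[ℂ] E) (B : F →ₗ.[ℂ] F) :
    Submodule ℂ (HilbertTensor E F × HilbertTensor E F) :=
  Submodule.span ℂ (Set.range fun p : A.domain × B.domain =>
    (pureTensor (p.1 : E) (p.2 : F),
      pureTensor (A p.1) (p.2 : F) + pureTensor (p.1 : E) (B p.2)))

/-- The operator `A ⊗ I + I ⊗ B` on the Hilbert space tensor product: the closure of the
operator `A ⊗ I + I ⊗ B` defined on the algebraic tensor product of the domains. -/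
def tensorSum {E F : Type*} [NormedAddCommGroup E] [InnerProductSpace ℂ E]
    [NormedAddCommGroup F] [InnerProductSpace ℂ F] (A : E →ₗ.[ℂ] E) (B : F →ₗ.[ℂ] F) :
    HilbertTensor E F →ₗ.[ℂ] HilbertTensor E F :=
  (algTensorSumGraph A B).topologicalClosure.toLinearPMap

/-- Complex `L²(ℝᵐ)`, with Lebesgue measure. -/
abbrev L2 (m : ℕ) : Type := Lp ℂ 2 (volume : Measure (EuclideanSpace ℝ (Fin m)))

/-- The graph of `-Δ` on `L²(ℝᵐ)`: the pairs `(f, g)` of `L²` functions with `-Δ f = g` in the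
sense of (tempered) distributions. -/
def negLaplacianGraph (m : ℕ) : Submodule ℂ (L2 m × L2 m) where
  carrier := {p | -Δ (p.1 : 𝓢'(EuclideanSpace ℝ (Fin m), ℂ)) =
    (p.2 : 𝓢'(EuclideanSpace ℝ (Fin m), ℂ))}
  add_mem' {p q} hp hq := by
    simp only [Set.mem_ofPred_eq, ← Lp.toTemperedDistributionCLM_apply,
      ← TemperedDistribution.laplacianCLM_apply, Prod.fst_add, Prod.snd_add, map_add] at hp hq ⊢
    rw [← hp, ← hq, neg_add]
  zero_mem' := by
    simp only [Set.mem_ofPred_eq, ← Lp.toTemperedDistributionCLM_apply,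
      ← TemperedDistribution.laplacianCLM_apply, Prod.fst_zero, Prod.snd_zero, map_zero, neg_zero]
  smul_mem' c p hp := by
    simp only [Set.mem_ofPred_eq, ← Lp.toTemperedDistributionCLM_apply,
      ← TemperedDistribution.laplacianCLM_apply, Prod.smul_fst, Prod.smul_snd, map_smul] at hp ⊢
    rw [← hp, smul_neg]

/-- The relation above is single-valued. -/
theorem negLaplacianGraph_snd_eq_zero (m : ℕ) (p : L2 m × L2 m) (hp : p ∈ negLaplacianGraph m)
    (h0 : p.1 = 0) : p.2 = 0 := by
  have h : -Δ (p.1 : 𝓢'(EuclideanSpace ℝ (Fin m), ℂ)) =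
    (p.2 : 𝓢'(EuclideanSpace ℝ (Fin m), ℂ)) := hp
  rw [h0, ← Lp.toTemperedDistributionCLM_apply, ← Lp.toTemperedDistributionCLM_apply,
    ← TemperedDistribution.laplacianCLM_apply, map_zero, map_zero, neg_zero] at h
  have h2 : p.2 ∈ (Lp.toTemperedDistributionCLM ℂ
      (volume : Measure (EuclideanSpace ℝ (Fin m))) 2).ker := h.symm
  rwa [Lp.ker_toTemperedDistributionCLM_eq_bot, Submodule.mem_bot] at h2

/-- The non-negative Laplacian `-Δ` on `L²(ℝᵐ)`, with its maximal domain
`{f ∈ L² | Δ f ∈ L²} = H²(ℝᵐ)`. -/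
def negLaplacian (m : ℕ) : L2 m →ₗ.[ℂ] L2 m := (negLaplacianGraph m).toLinearPMap

/-- A normalized mollifier: a smooth compactly supported function on `ℝᵐ` with integral one. -/
structure Mollifier (m : ℕ) where
  toFun : EuclideanSpace ℝ (Fin m) → ℂ
  contDiff : ContDiff ℝ ∞ toFun
  hasCompactSupport : HasCompactSupport toFun
  integral_eq_one : ∫ y, toFun y = 1

/-- `η_ε(y) = ε⁻ᵐ η(y / ε)`. -/
def Mollifier.scaled {m : ℕ} (η : Mollifier m) (ε : ℝ) (y : EuclideanSpace ℝ (Fin m)) : ℂ :=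
  (((ε ^ m)⁻¹ : ℝ) : ℂ) * η.toFun (ε⁻¹ • y)

theorem Mollifier.memLp_scaled {m : ℕ} (η : Mollifier m) (ε : ℝ) :
    MemLp (η.scaled ε) 2 (volume : Measure (EuclideanSpace ℝ (Fin m))) := by
  have hc : Continuous (η.scaled ε) := by
    have := η.contDiff.continuous
    unfold Mollifier.scaled
    fun_prop
  rcases eq_or_ne ε 0 with rfl | hε
  · rcases Nat.eq_zero_or_pos m with rfl | hm
    · exact hc.memLp_of_hasCompactSupport (HasCompactSupport.of_compactSpace _)
    · have h0 : η.scaled 0 = 0 := by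
        ext y
        simp [Mollifier.scaled, hm.ne']
      rw [h0]
      exact MemLp.zero
  · exact hc.memLp_of_hasCompactSupport
      ((η.hasCompactSupport.comp_smul (inv_ne_zero hε)).mul_left)

/-- The smeared source `R_ε J = J ⊗ η_ε` (used for `ε > 0`). -/
def smearedSource {H : Type*} [NormedAddCommGroup H] [InnerProductSpace ℂ H] {m : ℕ}
    (η : Mollifier m) (ε : ℝ) (J : H) : HilbertTensor H (L2 m) :=
  pureTensor J ((η.memLp_scaled ε).toLp (η.scaled ε))

/-- The ambient operator `L_M = L_B ⊗ I + I ⊗ (-Δ)` on `H_B ⊗ L²(ℝᵐ)`. -/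
def ambientOperator {H : Type*} [NormedAddCommGroup H] [InnerProductSpace ℂ H]
    (L : H →ₗ.[ℂ] H) (m : ℕ) : HilbertTensor H (L2 m) →ₗ.[ℂ] HilbertTensor H (L2 m) :=
  tensorSum L (negLaplacian m)

/-- The integrand `(2π)⁻ᵐ (L_B + |q|²)^(-s)`. -/
def transverseIntegrand {H : Type*} [NormedAddCommGroup H] [InnerProductSpace ℂ H]
    [CompleteSpace H] (L : H →ₗ.[ℂ] H) (m : ℕ) (s : ℝ) (q : EuclideanSpace ℝ (Fin m)) :
    H →L[ℂ] H :=
  ((2 * Real.pi) ^ m)⁻¹ • negPow (shift L (‖q‖ ^ 2)) s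

/-- `T_{m,s}(L_B) = ∫ d^mq / (2π)^m (L_B + |q|²)^(-s)`, a Bochner integral in operator norm. -/
def transverseOperator {H : Type*} [NormedAddCommGroup H] [InnerProductSpace ℂ H]
    [CompleteSpace H] (L : H →ₗ.[ℂ] H) (m : ℕ) (s : ℝ) : H →L[ℂ] H :=
  ∫ q : EuclideanSpace ℝ (Fin m), transverseIntegrand L m s q

end TransverseRestriction

end

open MeasureTheory Filter Topology BoundedContinuousFunction
open scoped TensorProduct ContDiff Laplacian SchwartzMap

set_option linter.unusedSectionVars false

namespace TransverseRestriction


/-! ### Bounded inverses of self-adjoint operators with a positive lower bound -/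

section Inverse

variable {H : Type*} [NormedAddCommGroup H] [InnerProductSpace ℂ H]

/-! The Fourier transform in `y` carries `H ⊗ L²(ℝᵐ)` onto `L²(ℝᵐ; H)` and turns the ambient
operator into multiplication by `L + |2πξ|²`. Its inverse is therefore multiplication by the bounded
continuous symbol `(L + |2πξ|²)⁻¹`; `isBoundedInverse_ambientOperator` proves this, including that
the closure of the algebraic operator is large enough.

No unbounded functional calculus is needed. With `R = L⁻¹`, every `(L + c)⁻¹` is the function `t /
(1 + c t)` of the single bounded operator `R`. Multiplication by a symbol and evaluation of a symbol
at `ξ` are both `*`-homomorphisms, and these commute with the continuous functional calculus. Hence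
`L_M⁻ˢ` is multiplication by `(L + |2πξ|²)⁻ˢ` (`exists_cfc_mulLp`).

The smeared pairing is then `∫ |η̂(εξ)|² ⟨J, (L + |2πξ|²)⁻ˢ K⟩ dξ`. Since `η̂` is bounded with
`η̂(0) = ∫ η = 1`, and the operator norm is at most `(l + |2πξ|²)⁻ˢ`, integrable because `s > m/2`,
dominated convergence gives the limit. The substitution `q = 2πξ` accounts for `(2π)⁻ᵐ`. -/

theorem BoundedBelowBy.mul_norm_le {L : H →ₗ.[ℂ] H} {l : ℝ} (h : BoundedBelowBy L l)
    (x : L.domain) : l * ‖(x : H)‖ ≤ ‖L x‖ := by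
  rcases eq_or_lt_of_le (norm_nonneg (x : H)) with hx | hx
  · rw [← hx, mul_zero]; exact norm_nonneg _
  · refine le_of_mul_le_mul_right ?_ hx
    calc l * ‖(x : H)‖ * ‖(x : H)‖ = l * ‖(x : H)‖ ^ 2 := by ring
      _ ≤ (inner ℂ (x : H) (L x)).re := h x
      _ ≤ ‖inner ℂ (x : H) (L x)‖ := Complex.re_le_norm _
      _ ≤ ‖(x : H)‖ * ‖L x‖ := norm_inner_le_norm _ _
      _ = ‖L x‖ * ‖(x : H)‖ := mul_comm _ _

theorem isSelfAdjoint_inner_apply [CompleteSpace H] {L : H →ₗ.[ℂ] H} (hL : IsSelfAdjoint L)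
    (x y : L.domain) : inner ℂ (L x) (y : H) = inner ℂ (x : H) (L y) := by
  have h := LinearPMap.adjoint_isFormalAdjoint hL.dense_domain
  rw [(LinearPMap.isSelfAdjoint_def.mp hL : L.adjoint = L)] at h
  exact h x y

/-- The graph of `L` is closed and the lower bound makes its second projection antilipschitz, so the
range is closed. A vector orthogonal to the range lies in the kernel of `L† = L`, which the lower
bound makes trivial. -/
theorem range_eq_top_of_isSelfAdjoint [CompleteSpace H] {L : H →ₗ.[ℂ] H} (hL : IsSelfAdjoint L)
    {l : ℝ} (hl : 0 < l) (h : BoundedBelowBy L l) : LinearMap.range L.toFun = ⊤ := by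
  have hgc : IsClosed (L.graph : Set (H × H)) := hL.isClosed
  have : CompleteSpace L.graph := hgc.completeSpace_coe
  -- The graph carries the sup norm: `l⁻¹` controls the first coordinate and `1` the second.
  have hanti : AntilipschitzWith (Real.toNNReal (max l⁻¹ 1))
      (fun p : L.graph => (p : H × H).2) := by
    refine AntilipschitzWith.of_le_mul_dist fun p q => ?_
    obtain ⟨⟨x, hx⟩, hx2⟩ := (LinearPMap.mem_graph_iff L).mp (p - q).2
    have hx1 : x = (p : H × H).1 - (q : H × H).1 := hx2.1
    have hx3 : L ⟨x, hx⟩ = (p : H × H).2 - (q : H × H).2 := hx2.2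
    rw [Real.coe_toNNReal _ (by positivity), Subtype.dist_eq, Prod.dist_eq, dist_eq_norm,
      dist_eq_norm, ← hx1, ← hx3]
    have h1 := h.mul_norm_le ⟨x, hx⟩
    have h2 : ‖x‖ ≤ l⁻¹ * ‖L ⟨x, hx⟩‖ := by
      rw [inv_mul_eq_div, le_div_iff₀ hl, mul_comm]; exact h1
    refine max_le (h2.trans ?_) ?_
    · gcongr; exact le_max_left _ _
    · exact le_mul_of_one_le_left (norm_nonneg _) (le_max_right _ _)
  have hcl : IsClosed (LinearMap.range L.toFun : Set H) := by
    have h3 : (LinearMap.range L.toFun : Set H) =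
        Set.range (fun p : L.graph => (p : H × H).2) := by
      ext y
      constructor
      · rintro ⟨x, rfl⟩
        exact ⟨⟨((x : H), L x), L.mem_graph x⟩, rfl⟩
      · rintro ⟨p, rfl⟩
        obtain ⟨x, hx⟩ := (LinearPMap.mem_graph_iff L).mp p.2
        exact ⟨x, hx.2⟩
    rw [h3]
    exact hanti.isClosed_range (uniformContinuous_snd.comp uniformContinuous_subtype_val)
  have : CompleteSpace (LinearMap.range L.toFun) := hcl.completeSpace_coe
  rw [← Submodule.orthogonal_eq_bot_iff, Submodule.eq_bot_iff]
  intro y hy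
  have hy0 : ∀ x : L.domain, inner ℂ (0 : H) (x : H) = inner ℂ y (L x) := fun x => by
    rw [inner_zero_left]
    exact (Submodule.inner_left_of_mem_orthogonal (LinearMap.mem_range_self L.toFun x) hy).symm
  have hyd := LinearPMap.mem_adjoint_domain_of_exists y ⟨0, hy0⟩
  have hz := LinearPMap.adjoint_apply_eq hL.dense_domain ⟨y, hyd⟩ hy0
  have hs : L.adjoint = L := hL
  -- Quantifying over `T` avoids transporting the domain membership of `y` along `L† = L`.
  have key : ∀ T : H →ₗ.[ℂ] H, T = L → ∀ hyT : y ∈ T.domain, T ⟨y, hyT⟩ = 0 → y = 0 := by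
    rintro T rfl hyT h0
    have := h.mul_norm_le ⟨y, hyT⟩
    rw [h0, norm_zero] at this
    have h5 : ‖y‖ ≤ 0 := nonpos_of_mul_nonpos_right this hl
    exact norm_le_zero_iff.mp h5
  exact key _ hs hyd hz

/-- A self-adjoint operator with a positive lower bound has a bounded inverse. -/
theorem exists_isBoundedInverse [CompleteSpace H] {L : H →ₗ.[ℂ] H} (hL : IsSelfAdjoint L)
    {l : ℝ} (hl : 0 < l) (h : BoundedBelowBy L l) :
    ∃ R : H →L[ℂ] H, IsBoundedInverse L R ∧ IsSelfAdjoint R ∧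
      spectrum ℝ R ⊆ Set.Icc 0 l⁻¹ := by
  have hinj : Function.Injective L.toFun := by
    rw [injective_iff_map_eq_zero]
    intro x hx
    have := h.mul_norm_le x
    rw [show L x = 0 from hx, norm_zero] at this
    exact Subtype.ext (norm_le_zero_iff.mp (nonpos_of_mul_nonpos_right this hl))
  let e : L.domain ≃ₗ[ℂ] H := LinearEquiv.ofBijective L.toFun
    ⟨hinj, LinearMap.range_eq_top.mp (range_eq_top_of_isSelfAdjoint hL hl h)⟩
  have he : ∀ y, L (e.symm y) = y := fun y => e.apply_symm_apply y
  have hbd : ∀ y, ‖(L.domain.subtype ∘ₗ e.symm.toLinearMap) y‖ ≤ l⁻¹ * ‖y‖ := by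
    intro y
    have h1 := h.mul_norm_le (e.symm y)
    rw [he] at h1
    rw [inv_mul_eq_div, le_div_iff₀ hl, mul_comm]
    exact h1
  let R : H →L[ℂ] H := (L.domain.subtype ∘ₗ e.symm.toLinearMap).mkContinuous l⁻¹ hbd
  have hR : ∀ y, R y = (e.symm y : H) := fun y => rfl
  have hRsym : ((R : H →L[ℂ] H) : H →ₗ[ℂ] H).IsSymmetric := by
    intro x y
    change inner ℂ (R x) y = inner ℂ x (R y)
    rw [hR, hR]
    have h1 := isSelfAdjoint_inner_apply hL (e.symm x) (e.symm y)
    rw [he, he] at h1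
    exact h1.symm
  -- Positivity gives the lower end of the spectrum, `‖R‖ ≤ l⁻¹` the upper end.
  have hRpos : R.IsPositive := by
    rw [ContinuousLinearMap.isPositive_def]
    refine ⟨hRsym, fun x => ?_⟩
    have h1 := h (e.symm x)
    rw [he] at h1
    rw [ContinuousLinearMap.reApplyInnerSelf_apply, hR]
    exact le_trans (by positivity) h1
  refine ⟨R, ⟨fun x => ?_, fun y => ⟨e.symm y, (hR y).symm, he y⟩⟩, hRpos.isSelfAdjoint, ?_⟩
  · rw [hR]; exact congrArg Subtype.val (e.symm_apply_apply x)
  · intro t ht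
    have h0 : 0 ≤ t := spectrum_nonneg_of_nonneg
      ((ContinuousLinearMap.nonneg_iff_isPositive R).mpr hRpos) ht
    refine ⟨h0, ?_⟩
    have h1 := spectrum.norm_le_norm_mul_of_mem ht
    rw [Real.norm_of_nonneg h0] at h1
    calc t ≤ ‖R‖ * ‖(1 : H →L[ℂ] H)‖ := h1
      _ ≤ ‖R‖ * 1 := by gcongr; exact ContinuousLinearMap.norm_id_le
      _ = ‖R‖ := mul_one _
      _ ≤ l⁻¹ := LinearMap.mkContinuous_norm_le _ (by positivity) _

/-- An operator with a bounded self-adjoint inverse is self-adjoint. -/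
theorem IsBoundedInverse.isSelfAdjoint [CompleteSpace H] {L : H →ₗ.[ℂ] H} {R : H →L[ℂ] H}
    (h : IsBoundedInverse L R) (hR : IsSelfAdjoint R) : IsSelfAdjoint L := by
  have hsym : ∀ x y, inner ℂ (R x) y = inner ℂ x (R y) := fun x y => hR.isSymmetric x y
  have hdense : Dense (L.domain : Set H) := by
    rw [Submodule.dense_iff_topologicalClosure_eq_top, Submodule.topologicalClosure_eq_top_iff,
      Submodule.eq_bot_iff]
    intro y hy
    obtain ⟨x, hx, hxy⟩ := h.2 y
    have hRy : R y = 0 := by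
      refine ext_inner_left ℂ fun z => ?_
      rw [inner_zero_right, ← hsym]
      obtain ⟨w, hw, -⟩ := h.2 z
      rw [← hw]
      exact Submodule.inner_right_of_mem_orthogonal w.2 hy
    have hx0 : x = 0 := Subtype.ext (hx.trans hRy)
    rw [← hxy, hx0, LinearPMap.map_zero]
  have hform : L.IsFormalAdjoint L := by
    intro x y
    have h1 := hsym (L x) (L y)
    rw [h.1, h.1] at h1
    exact h1.symm
  rw [LinearPMap.isSelfAdjoint_def]
  refine (LinearPMap.eq_of_le_of_domain_eq (LinearPMap.IsFormalAdjoint.le_adjoint hdense hform)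
    (le_antisymm (LinearPMap.IsFormalAdjoint.le_adjoint hdense hform).1 ?_)).symm
  -- Each `y` in the domain of `L†` equals `R (L† y)`, hence lies in the range of `R`, which is the
  -- domain of `L`.
  intro y hy
  have h1 := LinearPMap.adjoint_isFormalAdjoint hdense ⟨y, hy⟩
  have h2 : y = R (L.adjoint ⟨y, hy⟩) := by
    refine ext_inner_right ℂ fun w => ?_
    obtain ⟨x, hx, hxw⟩ := h.2 w
    have h3 := h1 x
    rw [hxw, hx, ← hsym] at h3
    exact h3.symm
  obtain ⟨x, hx, -⟩ := h.2 (L.adjoint ⟨y, hy⟩)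
  rw [h2, ← hx]
  exact x.2

end Inverse

/-! ### The inverses and powers of `L + c` as functions of `R = L⁻¹` -/

section ShiftedInverse

variable {H : Type*} [NormedAddCommGroup H] [InnerProductSpace ℂ H] [CompleteSpace H]

theorem one_add_mul_pos {c t l : ℝ} (hc : 0 ≤ c) (ht : t ∈ Set.Icc 0 l⁻¹) : 0 < 1 + c * t := by
  have := mul_nonneg hc ht.1
  linarith

/-- The inverse of `1 + c R`. -/
noncomputable def oneAddInv (R : H →L[ℂ] H) (c : ℝ) : H →L[ℂ] H :=
  cfc (fun t : ℝ => (1 + c * t)⁻¹) R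

/-- The inverse of `L + c`, expressed through the inverse `R` of `L`. -/
noncomputable def shiftedInv (R : H →L[ℂ] H) (c : ℝ) : H →L[ℂ] H :=
  cfc (fun t : ℝ => t * (1 + c * t)⁻¹) R

variable {R : H →L[ℂ] H} {l c : ℝ}

theorem continuousOn_one_add_inv (hspec : spectrum ℝ R ⊆ Set.Icc 0 l⁻¹) (hc : 0 ≤ c) :
    ContinuousOn (fun t : ℝ => (1 + c * t)⁻¹) (spectrum ℝ R) :=
  ContinuousOn.inv₀ (by fun_prop) fun _ ht => (one_add_mul_pos hc (hspec ht)).ne'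

theorem continuousOn_shifted (hspec : spectrum ℝ R ⊆ Set.Icc 0 l⁻¹) (hc : 0 ≤ c) :
    ContinuousOn (fun t : ℝ => t * (1 + c * t)⁻¹) (spectrum ℝ R) :=
  continuousOn_id.mul (continuousOn_one_add_inv hspec hc)

theorem cfc_one_add (hR : IsSelfAdjoint R) :
    cfc (fun t : ℝ => 1 + c * t) R = 1 + c • R := by
  rw [cfc_const_add 1 _ R, cfc_const_mul c _ R, cfc_id' ℝ R, map_one]

theorem one_add_mul_oneAddInv (hR : IsSelfAdjoint R) (hspec : spectrum ℝ R ⊆ Set.Icc 0 l⁻¹)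
    (hc : 0 ≤ c) : (1 + c • R) * oneAddInv R c = 1 := by
  rw [← cfc_one_add hR, oneAddInv, ← cfc_mul _ _ R (by fun_prop) (continuousOn_one_add_inv hspec hc),
    ← cfc_one ℝ R]
  exact cfc_congr fun t ht => mul_inv_cancel₀ (one_add_mul_pos hc (hspec ht)).ne'

theorem oneAddInv_mul_one_add (hR : IsSelfAdjoint R) (hspec : spectrum ℝ R ⊆ Set.Icc 0 l⁻¹)
    (hc : 0 ≤ c) : oneAddInv R c * (1 + c • R) = 1 := by
  rw [← cfc_one_add hR, oneAddInv, ← cfc_mul _ _ R (continuousOn_one_add_inv hspec hc) (by fun_prop),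
    ← cfc_one ℝ R]
  exact cfc_congr fun t ht => inv_mul_cancel₀ (one_add_mul_pos hc (hspec ht)).ne'

theorem shiftedInv_eq (hR : IsSelfAdjoint R) (hspec : spectrum ℝ R ⊆ Set.Icc 0 l⁻¹)
    (hc : 0 ≤ c) : shiftedInv R c = R * oneAddInv R c := by
  rw [shiftedInv, oneAddInv, cfc_mul _ _ R (by fun_prop) (continuousOn_one_add_inv hspec hc),
    cfc_id' ℝ R]

theorem isSelfAdjoint_shiftedInv : IsSelfAdjoint (shiftedInv R c) := cfc_predicate _ R

/-- On the domain of `L` one has `L + c = (1 + c R) L`, and `1 + c R` is invertible because `c ≥ 0`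
and `R` has non-negative spectrum. -/
theorem IsBoundedInverse.shift {L : H →ₗ.[ℂ] H} (h : IsBoundedInverse L R)
    (hR : IsSelfAdjoint R) (hspec : spectrum ℝ R ⊆ Set.Icc 0 l⁻¹) (hc : 0 ≤ c) :
    IsBoundedInverse (shift L c) (shiftedInv R c) := by
  have hcomm : shiftedInv R c = R * oneAddInv R c := shiftedInv_eq hR hspec hc
  have h1 : ∀ y, (1 + c • R) (oneAddInv R c y) = y := fun y =>
    DFunLike.congr_fun (one_add_mul_oneAddInv hR hspec hc) y
  have h2 : ∀ y, oneAddInv R c ((1 + c • R) y) = y := fun y =>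
    DFunLike.congr_fun (oneAddInv_mul_one_add hR hspec hc) y
  have hap : ∀ y, (1 + c • R) y = y + (c : ℂ) • R y := fun y => by
    simp [Complex.coe_smul]
  refine ⟨fun x => ?_, fun y => ?_⟩
  · change L.domain at x
    rw [shift_apply, hcomm]
    have h3 : (c : ℂ) • (x : H) + L x = (1 + c • R) (L x) := by rw [hap, h.1, add_comm]
    rw [h3, mul_apply_eq_comp, h2, h.1]
  · obtain ⟨x, hx, hxy⟩ := h.2 (oneAddInv R c y)
    refine ⟨x, ?_, ?_⟩
    · rw [hcomm, mul_apply_eq_comp]; exact hx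
    · rw [shift_apply, hxy]
      have h3 := h1 y
      rw [hap, ← hx, add_comm] at h3
      exact h3

theorem negPow_eq_cfc {L : H →ₗ.[ℂ] H} (h : IsBoundedInverse L R) (s : ℝ) :
    negPow L s = cfc (fun t : ℝ => t ^ s) R := by
  rw [negPow, boundedInverse_eq h]

theorem negPow_shift_eq_cfc {L : H →ₗ.[ℂ] H} (h : IsBoundedInverse L R) (hR : IsSelfAdjoint R)
    (hspec : spectrum ℝ R ⊆ Set.Icc 0 l⁻¹) (hc : 0 ≤ c) {s : ℝ} (hs : 0 ≤ s) :
    negPow (TransverseRestriction.shift L c) s =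
      cfc (fun t : ℝ => (t * (1 + c * t)⁻¹) ^ s) R := by
  rw [negPow_eq_cfc (h.shift hR hspec hc), shiftedInv,
    ← cfc_comp' (fun t : ℝ => t ^ s) (fun t : ℝ => t * (1 + c * t)⁻¹) R
      (Real.continuous_rpow_const hs).continuousOn (continuousOn_shifted hspec hc)]

/-- With `t = 1/λ` and `λ ≥ l` this is `(λ + c)⁻¹ ≤ (l + c)⁻¹`. -/
theorem norm_shifted_le (hl : 0 < l) {t : ℝ} (hc : 0 ≤ c) (ht : t ∈ Set.Icc 0 l⁻¹) :
    t * (1 + c * t)⁻¹ ≤ (l + c)⁻¹ := by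
  have hp := one_add_mul_pos hc ht
  rw [← div_eq_mul_inv, div_le_iff₀ hp, inv_mul_eq_div, le_div_iff₀ (by positivity)]
  have := ht.2
  rw [← one_div, le_div_iff₀ hl] at this
  linarith

theorem shifted_nonneg {t : ℝ} (hc : 0 ≤ c) (ht : t ∈ Set.Icc 0 l⁻¹) :
    0 ≤ t * (1 + c * t)⁻¹ :=
  mul_nonneg ht.1 (inv_nonneg.mpr (one_add_mul_pos hc ht).le)

theorem norm_cfc_rpow_shifted_le (hspec : spectrum ℝ R ⊆ Set.Icc 0 l⁻¹) (hl : 0 < l)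
    (hc : 0 ≤ c) {s : ℝ} (hs : 0 ≤ s) :
    ‖cfc (fun t : ℝ => (t * (1 + c * t)⁻¹) ^ s) R‖ ≤ (l + c) ^ (-s) := by
  refine norm_cfc_le (by positivity) fun t ht => ?_
  have h0 := shifted_nonneg hc (hspec ht)
  rw [Real.norm_of_nonneg (Real.rpow_nonneg h0 _), Real.rpow_neg (by positivity),
    ← Real.inv_rpow (by positivity)]
  exact Real.rpow_le_rpow h0 (norm_shifted_le hl hc (hspec ht)) hs

theorem norm_shiftedInv_le (hspec : spectrum ℝ R ⊆ Set.Icc 0 l⁻¹) (hl : 0 < l)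
    (hc : 0 ≤ c) : ‖shiftedInv R c‖ ≤ l⁻¹ := by
  have h := norm_cfc_rpow_shifted_le hspec hl hc zero_le_one
  simp only [Real.rpow_one] at h
  refine h.trans ?_
  rw [Real.rpow_neg_one]
  gcongr
  linarith

/-- Joint continuity in `(c, t)` makes the functions of `t` vary continuously in `c`, uniformly on
the compact spectrum of `R`; the functional calculus turns this into operator-norm continuity. -/
theorem continuousOn_cfc_rpow_shifted (hspec : spectrum ℝ R ⊆ Set.Icc 0 l⁻¹) {s : ℝ}
    (hs : 0 ≤ s) :
    ContinuousOn (fun c : ℝ => cfc (fun t : ℝ => (t * (1 + c * t)⁻¹) ^ s) R) (Set.Ici 0) := by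
  -- The absolute values keep the denominator positive on the whole plane and change nothing for `c
  -- ≥ 0` and `t` in the spectrum.
  let F : C(ℝ × ℝ, ℝ) := ⟨fun p => (|p.2| * (1 + |p.1| * |p.2|)⁻¹) ^ s, by
    refine Continuous.rpow_const (by
      refine Continuous.mul (by fun_prop) (Continuous.inv₀ (by fun_prop) fun p => ?_)
      positivity) fun _ => Or.inr hs⟩
  have hF : Continuous fun c : ℝ => cfc (F.curry c) R := by
    refine continuous_iff_continuousAt.mpr fun c => tendsto_cfc_fun ?_ ?_
    · exact ContinuousMap.tendsto_iff_forall_isCompact_tendstoUniformlyOn.mp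
        (F.curry.continuous.tendsto c) _ (spectrum.isCompact R)
    · exact Eventually.of_forall fun c => (F.curry c).continuous.continuousOn
  refine hF.continuousOn.congr fun c hc => cfc_congr fun t ht => ?_
  change _ = (|t| * (1 + |c| * |t|)⁻¹) ^ s
  rw [abs_of_nonneg (hspec ht).1, abs_of_nonneg (show 0 ≤ c from hc)]

end ShiftedInverse


/-! ### Multiplication operators with operator-valued symbols -/

section MulLp

variable {X H : Type*} [TopologicalSpace X] [SecondCountableTopology X] [MeasurableSpace X]
  [BorelSpace X] {μ : Measure X} [NormedAddCommGroup H] [InnerProductSpace ℂ H] [CompleteSpace H]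

theorem memLp_clm_apply (F : X →ᵇ (H →L[ℂ] H)) (g : Lp H 2 μ) :
    MemLp (fun x => F x (g x)) 2 μ := by
  refine MemLp.of_le_mul (c := ‖F‖) (Lp.memLp g) ?_ ?_
  · exact (isBoundedBilinearMap_apply
      (𝕜 := ℂ) (E := H) (F := H)).continuous.comp_aestronglyMeasurable₂ F.continuous.aestronglyMeasurable (Lp.aestronglyMeasurable g)
  · exact Eventually.of_forall fun x =>
      ((F x).le_opNorm _).trans (by gcongr; exact F.norm_coe_le_norm x)

/-- Multiplication of `L²` functions by a bounded continuous operator-valued function. -/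
noncomputable def mulLpFun (F : X →ᵇ (H →L[ℂ] H)) (g : Lp H 2 μ) : Lp H 2 μ :=
  (memLp_clm_apply F g).toLp _

theorem coeFn_mulLpFun (F : X →ᵇ (H →L[ℂ] H)) (g : Lp H 2 μ) :
    mulLpFun F g =ᵐ[μ] fun x => F x (g x) := MemLp.coeFn_toLp _

/-- `mulLpFun` as a bounded operator. -/
noncomputable def mulLpCLM (F : X →ᵇ (H →L[ℂ] H)) : Lp H 2 μ →L[ℂ] Lp H 2 μ :=
  LinearMap.mkContinuous
    { toFun := mulLpFun F
      map_add' := fun f g => by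
        refine Lp.ext ?_
        filter_upwards [coeFn_mulLpFun F (f + g), coeFn_mulLpFun F f, coeFn_mulLpFun F g,
          Lp.coeFn_add f g, Lp.coeFn_add (mulLpFun F f) (mulLpFun F g)] with x h1 h2 h3 h4 h5
        simp only [h1, h2, h3, h4, h5, Pi.add_apply, map_add]
      map_smul' := fun c f => by
        refine Lp.ext ?_
        filter_upwards [coeFn_mulLpFun F (c • f), coeFn_mulLpFun F f,
          Lp.coeFn_smul c f, Lp.coeFn_smul c (mulLpFun F f)] with x h1 h2 h3 h4
        simp only [RingHom.id_apply, h1, h2, h3, h4, Pi.smul_apply, map_smul] } ‖F‖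
    fun g => by
      refine Lp.norm_le_mul_norm_of_ae_le_mul ?_
      filter_upwards [coeFn_mulLpFun F g] with x h1
      simp only [LinearMap.coe_mk, AddHom.coe_mk, h1]
      exact ((F x).le_opNorm _).trans (by gcongr; exact F.norm_coe_le_norm x)

theorem coeFn_mulLpCLM (F : X →ᵇ (H →L[ℂ] H)) (g : Lp H 2 μ) :
    mulLpCLM F g =ᵐ[μ] fun x => F x (g x) := coeFn_mulLpFun F g

variable (μ) in
/-- The `*`-representation of bounded continuous operator-valued functions by multiplication
operators. -/
noncomputable def mulLp : (X →ᵇ (H →L[ℂ] H)) →⋆ₐ[ℂ] (Lp H 2 μ →L[ℂ] Lp H 2 μ) where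
  toFun := mulLpCLM
  map_one' := by
    ext1 g
    refine Lp.ext ?_
    filter_upwards [coeFn_mulLpCLM 1 g] with x h1
    rw [h1]; rfl
  map_mul' F G := by
    ext1 g
    refine Lp.ext ?_
    filter_upwards [coeFn_mulLpCLM (F * G) g, coeFn_mulLpCLM F (mulLpCLM G g),
      coeFn_mulLpCLM G g] with x h1 h2 h3
    rw [h1, mul_apply_eq_comp, h2, h3]; rfl
  map_zero' := by
    ext1 g
    refine Lp.ext ?_
    filter_upwards [coeFn_mulLpCLM 0 g, Lp.coeFn_zero H 2 μ] with x h1 h2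
    rw [h1]; exact h2.symm
  map_add' F G := by
    ext1 g
    refine Lp.ext ?_
    filter_upwards [coeFn_mulLpCLM (F + G) g, coeFn_mulLpCLM F g,
      coeFn_mulLpCLM G g, Lp.coeFn_add (mulLpCLM F g) (mulLpCLM G g)] with x h1 h2 h3 h4
    refine h1.trans (Eq.trans ?_ h4.symm)
    rw [Pi.add_apply, h2, h3]; rfl
  commutes' c := by
    ext1 g
    refine Lp.ext ?_
    filter_upwards [coeFn_mulLpCLM (algebraMap ℂ (X →ᵇ (H →L[ℂ] H)) c) g,
      Lp.coeFn_smul c g] with x h1 h2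
    rw [h1]; exact h2.symm
  map_star' F := by
    rw [ContinuousLinearMap.star_eq_adjoint, ContinuousLinearMap.eq_adjoint_iff]
    intro f g
    rw [L2.inner_def, L2.inner_def]
    refine integral_congr_ae ?_
    filter_upwards [coeFn_mulLpCLM (star F) f, coeFn_mulLpCLM F g] with x h1 h2
    rw [h1, h2, BoundedContinuousFunction.star_apply, ContinuousLinearMap.star_eq_adjoint,
      ContinuousLinearMap.adjoint_inner_left]

theorem coeFn_mulLp (F : X →ᵇ (H →L[ℂ] H)) (g : Lp H 2 μ) :
    mulLp μ F g =ᵐ[μ] fun x => F x (g x) := coeFn_mulLpFun F g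

/-- Evaluation at a point, as a `*`-homomorphism. -/
noncomputable def evalStarAlgHom (H : Type*) [NormedAddCommGroup H] [InnerProductSpace ℂ H]
    [CompleteSpace H] (x : X) : (X →ᵇ (H →L[ℂ] H)) →⋆ₐ[ℂ] (H →L[ℂ] H) where
  toFun F := F x
  map_one' := rfl
  map_mul' _ _ := rfl
  map_zero' := rfl
  map_add' _ _ := rfl
  commutes' _ := rfl
  map_star' _ := rfl

open scoped CStarAlgebra in
-- The one element `f(a)` serves all the homomorphisms at once. This allows the functional calculus
-- of a multiplication operator to be computed pointwise in its symbol.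
theorem exists_cfc_of_starAlgHoms {A B C ι : Type*} [CStarAlgebra A] [CStarAlgebra B]
    [CStarAlgebra C] (φ : A →⋆ₐ[ℂ] B) (ψ : ι → A →⋆ₐ[ℂ] C) (a : A) (ha : IsSelfAdjoint a)
    {f : ℝ → ℝ} (hf : Continuous f) :
    ∃ b : A, φ b = cfc f (φ a) ∧ ∀ i, ψ i b = cfc f (ψ i a) :=
  ⟨cfc f a, StarAlgHom.map_cfc φ f a hf.continuousOn (map_continuous φ) ha (ha.map φ), fun i =>
    StarAlgHom.map_cfc (ψ i) f a hf.continuousOn (map_continuous (ψ i)) ha (ha.map (ψ i))⟩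

theorem exists_cfc_mulLp {B : Type*} [CStarAlgebra B] (φ : (X →ᵇ (H →L[ℂ] H)) →⋆ₐ[ℂ] B)
    (F : X →ᵇ (H →L[ℂ] H)) (hF : IsSelfAdjoint F) {f : ℝ → ℝ} (hf : Continuous f) :
    ∃ G : X →ᵇ (H →L[ℂ] H), φ G = cfc f (φ F) ∧ ∀ x, G x = cfc f (F x) :=
  exists_cfc_of_starAlgHoms φ (evalStarAlgHom H) F hF hf

end MulLp


/-! ### `H ⊗ L²` inside the vector-valued `L²` space -/

section Tensor

variable {X H : Type*} [MeasurableSpace X] {μ : Measure X}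
  [NormedAddCommGroup H] [InnerProductSpace ℂ H]

/-- The function `x ↦ f x • a`. -/
noncomputable def smulVec (a : H) (f : Lp ℂ 2 μ) : Lp H 2 μ :=
  (ContinuousLinearMap.toSpanSingleton ℂ a).compLp f

theorem coeFn_smulVec (a : H) (f : Lp ℂ 2 μ) : smulVec a f =ᵐ[μ] fun x => f x • a := by
  filter_upwards [(ContinuousLinearMap.toSpanSingleton ℂ a).coeFn_compLp f] with x hx
  rw [smulVec, hx, ContinuousLinearMap.toSpanSingleton_apply]

theorem inner_smulVec (a b : H) (f g : Lp ℂ 2 μ) :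
    inner ℂ (smulVec a f) (smulVec b g) = inner ℂ a b * inner ℂ f g := by
  rw [L2.inner_def, L2.inner_def, ← integral_const_mul]
  refine integral_congr_ae ?_
  filter_upwards [coeFn_smulVec a f, coeFn_smulVec b g] with x h1 h2
  rw [h1, h2, inner_smul_left, inner_smul_right, RCLike.inner_apply]
  ring

variable (H μ) in
/-- The linear map `a ⊗ f ↦ (x ↦ f x • a)`. -/
noncomputable def tensorToLp : H ⊗[ℂ] (Lp ℂ 2 μ) →ₗ[ℂ] Lp H 2 μ :=
  TensorProduct.lift (LinearMap.mk₂ ℂ smulVec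
    (fun a b f => by
      refine Lp.ext ?_
      filter_upwards [coeFn_smulVec a f, coeFn_smulVec b f, coeFn_smulVec (a + b) f,
        Lp.coeFn_add (smulVec a f) (smulVec b f)] with x h1 h2 h3 h4
      rw [h3, h4, Pi.add_apply, h1, h2, smul_add])
    (fun c a f => by
      refine Lp.ext ?_
      filter_upwards [coeFn_smulVec a f, coeFn_smulVec (c • a) f,
        Lp.coeFn_smul c (smulVec a f)] with x h1 h2 h3
      rw [h3, h2, Pi.smul_apply, h1, smul_comm])
    (fun a f g => by
      refine Lp.ext ?_
      filter_upwards [coeFn_smulVec a f, coeFn_smulVec a g, coeFn_smulVec a (f + g),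
        Lp.coeFn_add (smulVec a f) (smulVec a g), Lp.coeFn_add f g] with x h1 h2 h3 h4 h5
      rw [h3, h4, Pi.add_apply, h1, h2, h5, Pi.add_apply, add_smul])
    (fun c a f => by
      refine Lp.ext ?_
      filter_upwards [coeFn_smulVec a f, coeFn_smulVec a (c • f),
        Lp.coeFn_smul c (smulVec a f), Lp.coeFn_smul c f] with x h1 h2 h3 h4
      rw [h3, h2, Pi.smul_apply, h1, h4, Pi.smul_apply, smul_assoc]))

theorem tensorToLp_tmul (a : H) (f : Lp ℂ 2 μ) : tensorToLp H μ (a ⊗ₜ f) = smulVec a f := rfl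

theorem inner_tensorToLp (x y : H ⊗[ℂ] (Lp ℂ 2 μ)) :
    inner ℂ (tensorToLp H μ x) (tensorToLp H μ y) = inner ℂ x y := by
  induction x with
  | zero => simp
  | add x₁ x₂ h₁ h₂ => rw [map_add, inner_add_left, inner_add_left, h₁, h₂]
  | tmul a f =>
    induction y with
    | zero => simp
    | add y₁ y₂ h₁ h₂ => rw [map_add, inner_add_right, inner_add_right, h₁, h₂]
    | tmul b g =>
      rw [tensorToLp_tmul, tensorToLp_tmul, inner_smulVec, TensorProduct.inner_tmul]

/-- The range contains every `1_s • c` with `s` of finite measure, and these span the simple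
functions, which are dense in `L²`. -/
theorem denseRange_tensorToLp : DenseRange (tensorToLp H μ) := by
  intro g
  change g ∈ closure ((LinearMap.range (tensorToLp H μ) : Submodule ℂ (Lp H 2 μ)) : Set (Lp H 2 μ))
  rw [← Submodule.topologicalClosure_coe, SetLike.mem_coe]
  refine Lp.induction (by norm_num) (motive := fun g =>
    g ∈ (LinearMap.range (tensorToLp H μ)).topologicalClosure) ?_ ?_ ?_ g
  · intro c s hs hμs
    refine Submodule.le_topologicalClosure _ ⟨c ⊗ₜ indicatorConstLp 2 hs hμs.ne (1 : ℂ), ?_⟩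
    rw [tensorToLp_tmul]
    refine Lp.ext ?_
    rw [Lp.simpleFunc.coe_indicatorConst]
    filter_upwards [coeFn_smulVec c (indicatorConstLp 2 hs hμs.ne (1 : ℂ)),
      indicatorConstLp_coeFn (p := 2) (hs := hs) (hμs := hμs.ne) (c := (1 : ℂ)),
      indicatorConstLp_coeFn (p := 2) (hs := hs) (hμs := hμs.ne) (c := c)] with x h1 h2 h3
    rw [h1, h2, h3]
    by_cases hx : x ∈ s <;> simp [hx]
  · intro f g hf hg _ h1 h2
    exact add_mem h1 h2
  · exact Submodule.isClosed_topologicalClosure _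

end Tensor

/-! ### The partial Fourier transform as a unitary map -/

section Fourier

open FourierTransform

variable {H : Type*} [NormedAddCommGroup H] [InnerProductSpace ℂ H] [CompleteSpace H] {m : ℕ}

variable (H m) in
/-- The partial Fourier transform on the algebraic tensor product. -/
noncomputable def algPartialFourier :
    H ⊗[ℂ] (L2 m) →ₗᵢ[ℂ] Lp H 2 (volume : Measure (EuclideanSpace ℝ (Fin m))) :=
  ((tensorToLp H volume).isometryOfInner inner_tensorToLp).comp
    (TensorProduct.congrIsometry (LinearIsometryEquiv.refl ℂ H)
      (Lp.fourierTransformₗᵢ (EuclideanSpace ℝ (Fin m)) ℂ)).toLinearIsometry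

theorem denseRange_algPartialFourier : DenseRange (algPartialFourier H m) := by
  have h := (TensorProduct.congrIsometry (LinearIsometryEquiv.refl ℂ H)
      (Lp.fourierTransformₗᵢ (EuclideanSpace ℝ (Fin m)) ℂ)).surjective
  exact (denseRange_tensorToLp (H := H) (μ := (volume : Measure (EuclideanSpace ℝ (Fin m))))).comp
    h.denseRange (tensorToLp H volume |>.isometryOfInner inner_tensorToLp).continuous

variable (H m) in
/-- The partial Fourier transform on the Hilbert space tensor product, as a unitary map onto the
space of square integrable vector-valued functions. -/
noncomputable def partialFourier :
    HilbertTensor H (L2 m) ≃ₗᵢ[ℂ] Lp H 2 (volume : Measure (EuclideanSpace ℝ (Fin m))) :=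
  (LinearEquiv.refl ℂ (H ⊗[ℂ] L2 m)).extendOfIsometry
    (UniformSpace.Completion.toComplₗᵢ (𝕜 := ℂ) (E := H ⊗[ℂ] L2 m)).toLinearMap
    (algPartialFourier H m).toLinearMap
    UniformSpace.Completion.denseRange_coe denseRange_algPartialFourier
    fun x => by
      exact ((algPartialFourier H m).norm_map x).trans (UniformSpace.Completion.norm_coe x).symm

theorem partialFourier_pureTensor (a : H) (f : L2 m) :
    partialFourier H m (pureTensor a f) = smulVec a (𝓕 f) :=
  LinearEquiv.extendOfIsometry_eq _ _ _ _ _ _ (a ⊗ₜ f)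

end Fourier

/-! ### The Laplacian on the Fourier side -/

section Laplacian

open FourierTransform

variable {m : ℕ}

/-- On tempered distributions `-Δ` is the Fourier multiplier `(2π)²|ξ|²`, and the Fourier transform
is injective there; the resulting identity is tested on Schwartz functions. -/
theorem neg_laplacian_eq_iff (f g : L2 m) :
    (-Δ (f : 𝓢'(EuclideanSpace ℝ (Fin m), ℂ)) = (g : 𝓢'(EuclideanSpace ℝ (Fin m), ℂ))) ↔
      ∀ u : 𝓢(EuclideanSpace ℝ (Fin m), ℂ),
        ∫ x, u x • ((((2 * Real.pi) ^ 2 * ‖x‖ ^ 2 : ℝ) : ℂ) * (𝓕 f : L2 m) x) =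
          ∫ x, u x • (𝓕 g : L2 m) x := by
  have hT : (fun x : EuclideanSpace ℝ (Fin m) ↦ Complex.ofReal (‖x‖ ^ 2)).HasTemperateGrowth := by
    fun_prop
  have hneg : -Δ (f : 𝓢'(EuclideanSpace ℝ (Fin m), ℂ)) =
      𝓕⁻ (((2 * Real.pi) ^ 2 : ℂ) • TemperedDistribution.smulLeftCLM ℂ
        (fun x ↦ Complex.ofReal (‖x‖ ^ 2))
        ((𝓕 f : L2 m) : 𝓢'(EuclideanSpace ℝ (Fin m), ℂ))) := by
    rw [TemperedDistribution.laplacian_eq_fourierMultiplierCLM,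
      TemperedDistribution.fourierMultiplierCLM_apply, Lp.fourier_toTemperedDistribution_eq,
      FourierTransform.fourierInv_smul, neg_smul, neg_neg, ← Complex.coe_smul]
    norm_cast
  have hiff : -Δ (f : 𝓢'(EuclideanSpace ℝ (Fin m), ℂ)) = (g : 𝓢'(EuclideanSpace ℝ (Fin m), ℂ)) ↔
      (((2 * Real.pi) ^ 2 : ℂ) • TemperedDistribution.smulLeftCLM ℂ
        (fun x ↦ Complex.ofReal (‖x‖ ^ 2))
        ((𝓕 f : L2 m) : 𝓢'(EuclideanSpace ℝ (Fin m), ℂ))) =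
      ((𝓕 g : L2 m) : 𝓢'(EuclideanSpace ℝ (Fin m), ℂ)) := by
    rw [hneg, ← Lp.fourier_toTemperedDistribution_eq g]
    constructor
    · intro h
      rw [← h, FourierTransform.fourier_fourierInv_eq]
    · intro h
      rw [h, FourierTransform.fourierInv_fourier_eq]
  rw [hiff, DFunLike.ext_iff]
  refine forall_congr' fun u => ?_
  have h1 : (((2 * Real.pi) ^ 2 : ℂ) • TemperedDistribution.smulLeftCLM ℂ
        (fun x ↦ Complex.ofReal (‖x‖ ^ 2))
        ((𝓕 f : L2 m) : 𝓢'(EuclideanSpace ℝ (Fin m), ℂ))) u =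
      ((2 * Real.pi) ^ 2 : ℂ) • ((𝓕 f : L2 m) : 𝓢'(EuclideanSpace ℝ (Fin m), ℂ))
        (SchwartzMap.smulLeftCLM ℂ (fun x ↦ Complex.ofReal (‖x‖ ^ 2)) u) := rfl
  rw [h1, Lp.toTemperedDistribution_apply, Lp.toTemperedDistribution_apply, smul_eq_mul,
    ← integral_const_mul]
  refine Eq.congr (integral_congr_ae (Eventually.of_forall fun x => ?_)) rfl
  simp only [SchwartzMap.smulLeftCLM_apply_apply hT, smul_eq_mul]
  push_cast
  ring

/-- The Laplacian is multiplication by `|2 π ξ|²` on the Fourier side. -/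
theorem mem_negLaplacianGraph_iff (p : L2 m × L2 m) :
    p ∈ negLaplacianGraph m ↔
      ∀ᵐ x, (((2 * Real.pi) ^ 2 * ‖x‖ ^ 2 : ℝ) : ℂ) * (𝓕 p.1 : L2 m) x = (𝓕 p.2 : L2 m) x := by
  refine (neg_laplacian_eq_iff p.1 p.2).trans ⟨fun h => ?_, fun h u => ?_⟩
  -- Real test functions of compact support are Schwartz and already separate locally integrable
  -- functions.
  · refine ae_eq_of_integral_contDiff_smul_eq ?_ ?_ fun u hu hc => ?_
    · have h2 : LocallyIntegrable (𝓕 p.1 : L2 m) volume :=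
        (Lp.memLp _).locallyIntegrable (by norm_num)
      exact h2.continuous_mul (by fun_prop)
    · exact (Lp.memLp _).locallyIntegrable (by norm_num)
    · have hg₁ : HasCompactSupport (Complex.ofRealCLM ∘ u) := hc.comp_left rfl
      have hg₂ : ContDiff ℝ ∞ (Complex.ofRealCLM ∘ u) := by fun_prop
      have h1 := h (hg₁.toSchwartzMap hg₂)
      simpa using h1
  · refine integral_congr_ae ?_
    filter_upwards [h] with x hx
    rw [hx]

theorem graph_negLaplacian : (negLaplacian m).graph = negLaplacianGraph m :=
  Submodule.toLinearPMap_graph_eq _ (negLaplacianGraph_snd_eq_zero m)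

end Laplacian


/-! ### The ambient operator as a momentum multiplier -/

section Ambient

open FourierTransform

variable {H : Type*} [NormedAddCommGroup H] [InnerProductSpace ℂ H] [CompleteSpace H] {m : ℕ}

/-- The Fourier symbol `|2 π ξ|²` of `-Δ`. -/
noncomputable def laplaceSymbol (x : EuclideanSpace ℝ (Fin m)) : ℝ := (2 * Real.pi) ^ 2 * ‖x‖ ^ 2

theorem laplaceSymbol_nonneg (x : EuclideanSpace ℝ (Fin m)) : 0 ≤ laplaceSymbol x := by
  unfold laplaceSymbol; positivity

theorem continuous_laplaceSymbol : Continuous (laplaceSymbol (m := m)) := by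
  unfold laplaceSymbol; fun_prop

variable (H m) in
/-- Operator-valued functions of the transverse momentum, as operators on `H ⊗ L²(ℝᵐ)`. -/
noncomputable def momentumMultiplier : (EuclideanSpace ℝ (Fin m) →ᵇ (H →L[ℂ] H)) →⋆ₐ[ℂ]
    (HilbertTensor H (L2 m) →L[ℂ] HilbertTensor H (L2 m)) :=
  ((partialFourier H m).symm.conjStarAlgEquiv :
    _ →⋆ₐ[ℂ] (HilbertTensor H (L2 m) →L[ℂ] HilbertTensor H (L2 m))).comp (mulLp volume)

theorem partialFourier_momentumMultiplier (F : EuclideanSpace ℝ (Fin m) →ᵇ (H →L[ℂ] H))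
    (x : HilbertTensor H (L2 m)) :
    partialFourier H m (momentumMultiplier H m F x) = mulLp volume F (partialFourier H m x) :=
  (partialFourier H m).apply_symm_apply _

variable {R : H →L[ℂ] H} {l : ℝ}

variable (m) in
/-- The symbol `ξ ↦ (L + |2 π ξ|²)⁻¹` of the inverse of the ambient operator. -/
noncomputable def resolventSymbol (hspec : spectrum ℝ R ⊆ Set.Icc 0 l⁻¹) (hl : 0 < l) :
    EuclideanSpace ℝ (Fin m) →ᵇ (H →L[ℂ] H) :=
  BoundedContinuousFunction.ofNormedAddCommGroup (fun x => shiftedInv R (laplaceSymbol x))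
    (by
      have h := continuousOn_cfc_rpow_shifted hspec zero_le_one
      simp only [Real.rpow_one] at h
      exact h.comp_continuous continuous_laplaceSymbol laplaceSymbol_nonneg)
    l⁻¹ fun x => norm_shiftedInv_le hspec hl (laplaceSymbol_nonneg x)

theorem resolventSymbol_apply (hspec : spectrum ℝ R ⊆ Set.Icc 0 l⁻¹) (hl : 0 < l)
    (x : EuclideanSpace ℝ (Fin m)) :
    resolventSymbol m hspec hl x = shiftedInv R (laplaceSymbol x) := rfl

theorem isSelfAdjoint_resolventSymbol (hspec : spectrum ℝ R ⊆ Set.Icc 0 l⁻¹) (hl : 0 < l) :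
    IsSelfAdjoint (resolventSymbol m hspec hl) := by
  ext1 x
  exact isSelfAdjoint_shiftedInv

variable {L : H →ₗ.[ℂ] H}

theorem fourier_negLaplacian (v : (negLaplacian m).domain) :
    ∀ᵐ x, ((laplaceSymbol x : ℝ) : ℂ) * (𝓕 (v : L2 m) : L2 m) x =
      (𝓕 (negLaplacian m v) : L2 m) x := by
  have h : ((v : L2 m), negLaplacian m v) ∈ negLaplacianGraph m := by
    rw [← graph_negLaplacian]; exact (negLaplacian m).mem_graph v
  filter_upwards [(mem_negLaplacianGraph_iff _).mp h] with x hx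
  exact hx

/-- After the Fourier transform the argument is `v̂(ξ) (L + |2πξ|²) u`, and the symbol cancels the
operator factor. -/
theorem momentumMultiplier_resolventSymbol_apply (h : IsBoundedInverse L R)
    (hR : IsSelfAdjoint R) (hspec : spectrum ℝ R ⊆ Set.Icc 0 l⁻¹) (hl : 0 < l)
    (u : L.domain) (v : (negLaplacian m).domain) :
    momentumMultiplier H m (resolventSymbol m hspec hl)
      (pureTensor (L u) (v : L2 m) + pureTensor (u : H) (negLaplacian m v)) =
      pureTensor (u : H) (v : L2 m) := by
  apply (partialFourier H m).injective
  rw [partialFourier_momentumMultiplier, map_add, partialFourier_pureTensor,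
    partialFourier_pureTensor, partialFourier_pureTensor]
  refine Lp.ext ?_
  filter_upwards [coeFn_mulLp (resolventSymbol m hspec hl)
      (smulVec (L u) (𝓕 (v : L2 m)) + smulVec (u : H) (𝓕 (negLaplacian m v))),
    Lp.coeFn_add (smulVec (L u) (𝓕 (v : L2 m))) (smulVec (u : H) (𝓕 (negLaplacian m v))),
    coeFn_smulVec (L u) (𝓕 (v : L2 m)), coeFn_smulVec (u : H) (𝓕 (negLaplacian m v)),
    coeFn_smulVec (u : H) (𝓕 (v : L2 m)), fourier_negLaplacian v] with x h1 h2 h3 h4 h5 h6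
  rw [h1, h2, Pi.add_apply, h3, h4, h5, ← h6, resolventSymbol_apply, mul_comm, mul_smul, ← smul_add,
    map_smul]
  congr 1
  rw [add_comm]
  exact (h.shift hR hspec (laplaceSymbol_nonneg x)).1 u

variable (m) in
/-- The normalized symbol `ξ ↦ (1 + |2 π ξ|²)⁻¹ (1 + |2 π ξ|² R)`. -/
noncomputable def normalizedSymbol (R : H →L[ℂ] H) : EuclideanSpace ℝ (Fin m) →ᵇ (H →L[ℂ] H) :=
  BoundedContinuousFunction.ofNormedAddCommGroup
    (fun x => (1 + laplaceSymbol x)⁻¹ • (1 + laplaceSymbol x • R))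
    (by
      have h := continuous_laplaceSymbol (m := m)
      refine Continuous.smul (Continuous.inv₀ (continuous_const.add h) fun x => ?_)
        (continuous_const.add (h.smul continuous_const))
      have := laplaceSymbol_nonneg x
      exact (by linarith : 0 < 1 + laplaceSymbol x).ne')
    (‖(1 : H →L[ℂ] H)‖ + ‖R‖) (by
      intro x
      have h0 := laplaceSymbol_nonneg x
      rw [norm_smul, norm_inv, Real.norm_of_nonneg (by positivity), inv_mul_le_iff₀ (by positivity)]
      calc ‖1 + laplaceSymbol x • R‖ ≤ ‖(1 : H →L[ℂ] H)‖ + laplaceSymbol x * ‖R‖ := by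
            refine (norm_add_le _ _).trans ?_
            rw [norm_smul, Real.norm_of_nonneg h0]
        _ ≤ _ := by nlinarith [norm_nonneg (1 : H →L[ℂ] H), norm_nonneg R,
            mul_nonneg h0 (norm_nonneg (1 : H →L[ℂ] H))])

theorem normalizedSymbol_apply (x : EuclideanSpace ℝ (Fin m)) :
    normalizedSymbol m R x = (1 + laplaceSymbol x)⁻¹ • (1 + laplaceSymbol x • R) := rfl

theorem isSelfAdjoint_normalizedSymbol (hR : IsSelfAdjoint R) :
    IsSelfAdjoint (normalizedSymbol m R) := by
  ext1 x
  change star (normalizedSymbol m R x) = normalizedSymbol m R x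
  rw [normalizedSymbol_apply]
  exact IsSelfAdjoint.smul (IsSelfAdjoint.all _)
    ((IsSelfAdjoint.one _).add (IsSelfAdjoint.smul (IsSelfAdjoint.all _) hR))

/-- `mulLp` of a symbol with injective values is injective. -/
theorem mulLp_eq_zero {F : EuclideanSpace ℝ (Fin m) →ᵇ (H →L[ℂ] H)}
    (hF : ∀ x y, F x y = 0 → y = 0) {g : Lp H 2 (volume : Measure (EuclideanSpace ℝ (Fin m)))}
    (hg : mulLp volume F g = 0) : g = 0 := by
  rw [Lp.eq_zero_iff_ae_eq_zero]
  have h0 := Lp.coeFn_zero H 2 (volume : Measure (EuclideanSpace ℝ (Fin m)))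
  rw [← hg] at h0
  filter_upwards [h0, coeFn_mulLp F g] with x h1 h2
  exact hF x _ (h2.symm.trans h1)

/-- The orthogonal complement of the range of a bounded self-adjoint operator is its kernel. -/
theorem denseRange_mulLp {F : EuclideanSpace ℝ (Fin m) →ᵇ (H →L[ℂ] H)} (hFs : IsSelfAdjoint F)
    (hF : ∀ x y, F x y = 0 → y = 0) :
    DenseRange (mulLp (volume : Measure (EuclideanSpace ℝ (Fin m))) F) := by
  have h : IsSelfAdjoint (mulLp (volume : Measure (EuclideanSpace ℝ (Fin m))) F) :=
    hFs.map (mulLp volume)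
  change Dense ((LinearMap.range (mulLp (volume : Measure (EuclideanSpace ℝ (Fin m)))
    F).toLinearMap : Submodule ℂ _) : Set (Lp H 2 (volume : Measure (EuclideanSpace ℝ (Fin m)))))
  rw [Submodule.dense_iff_topologicalClosure_eq_top, Submodule.topologicalClosure_eq_top_iff,
    Submodule.eq_bot_iff]
  intro g hg
  refine mulLp_eq_zero hF (ext_inner_right ℂ fun w => ?_)
  rw [inner_zero_left]
  have h1 : inner ℂ (mulLp volume F g) w = inner ℂ g (mulLp volume F w) := h.isSymmetric g w
  rw [h1]
  exact Submodule.inner_left_of_mem_orthogonal (LinearMap.mem_range_self _ w) hg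

theorem normalizedSymbol_injective (hR : IsSelfAdjoint R)
    (hspec : spectrum ℝ R ⊆ Set.Icc 0 l⁻¹) (x : EuclideanSpace ℝ (Fin m)) (y : H)
    (hy : normalizedSymbol m R x y = 0) : y = 0 := by
  have h0 := laplaceSymbol_nonneg x
  have h1 : (1 + laplaceSymbol x)⁻¹ • ((1 + laplaceSymbol x • R) y) = 0 := hy
  rw [smul_eq_zero_iff_right (by positivity)] at h1
  have h2 := DFunLike.congr_fun (oneAddInv_mul_one_add hR hspec h0) y
  rw [mul_apply_eq_comp, h1, map_zero] at h2
  exact h2.symm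

/-- A bounded continuous real function as a symbol with scalar values. -/
noncomputable def scalarSymbol (f : EuclideanSpace ℝ (Fin m) → ℝ) (hf : Continuous f) (C : ℝ)
    (hC : ∀ x, |f x| ≤ C) : EuclideanSpace ℝ (Fin m) →ᵇ (ℂ →L[ℂ] ℂ) :=
  BoundedContinuousFunction.ofNormedAddCommGroup (fun x => f x • 1) (by fun_prop) C (fun x => by
    rw [norm_smul, norm_one, mul_one]; exact hC x)

theorem exists_fourier_mul (f : EuclideanSpace ℝ (Fin m) → ℝ) (hf : Continuous f) (C : ℝ)
    (hC : ∀ x, |f x| ≤ C) (g : L2 m) :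
    ∃ v : L2 m, ∀ᵐ x, (𝓕 v : L2 m) x = (f x : ℂ) * g x := by
  refine ⟨𝓕⁻ (mulLp volume (scalarSymbol f hf C hC) g : L2 m), ?_⟩
  rw [FourierTransform.fourier_fourierInv_eq]
  filter_upwards [coeFn_mulLp (scalarSymbol f hf C hC) g] with x hx
  rw [hx]
  change f x • g x = _
  rw [← Complex.coe_smul, smul_eq_mul]

/-- Take `u = R w` and `v̂ = (1 + |2πξ|²)⁻¹ g`: the factor puts `v` in the domain of `-Δ`, and `v̂
(L + |2πξ|²) u` is the normalized symbol applied to `g w`. -/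
theorem mulLp_normalizedSymbol_smulVec_mem (h : IsBoundedInverse L R) (w : H) (g : L2 m) :
    ∃ (u : L.domain) (v : (negLaplacian m).domain),
      partialFourier H m (pureTensor (L u) (v : L2 m) + pureTensor (u : H) (negLaplacian m v)) =
        mulLp volume (normalizedSymbol m R) (smulVec w g) := by
  obtain ⟨u, hu, huw⟩ := h.2 w
  have hpos : ∀ x : EuclideanSpace ℝ (Fin m), 0 < 1 + laplaceSymbol x := fun x => by
    have := laplaceSymbol_nonneg x
    positivity
  have hc1 : Continuous fun x : EuclideanSpace ℝ (Fin m) => (1 + laplaceSymbol x)⁻¹ :=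
    Continuous.inv₀ (continuous_const.add continuous_laplaceSymbol) fun x => (hpos x).ne'
  obtain ⟨v, hv⟩ := exists_fourier_mul (fun x : EuclideanSpace ℝ (Fin m) => (1 + laplaceSymbol x)⁻¹)
    hc1 1 (fun x => by
      rw [abs_of_pos (inv_pos.mpr (hpos x))]
      exact inv_le_one_of_one_le₀ (by linarith [laplaceSymbol_nonneg x])) g
  obtain ⟨v', hv'⟩ := exists_fourier_mul
    (fun x : EuclideanSpace ℝ (Fin m) => laplaceSymbol x * (1 + laplaceSymbol x)⁻¹)
    (continuous_laplaceSymbol.mul hc1) 1 (fun x => by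
      rw [abs_of_nonneg (mul_nonneg (laplaceSymbol_nonneg x) (inv_pos.mpr (hpos x)).le),
        ← div_eq_mul_inv, div_le_one (hpos x)]
      linarith) g
  have hmem : (v, v') ∈ (negLaplacian m).graph := by
    rw [graph_negLaplacian, mem_negLaplacianGraph_iff]
    filter_upwards [hv, hv'] with x h1 h2
    change ((laplaceSymbol x : ℝ) : ℂ) * _ = _
    rw [h1, h2]
    push_cast
    ring
  obtain ⟨v₀, hv₀, hv₀'⟩ := (LinearPMap.mem_graph_iff _).mp hmem
  refine ⟨u, v₀, ?_⟩
  rw [map_add, partialFourier_pureTensor, partialFourier_pureTensor, huw, hu, hv₀', hv₀]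
  refine Lp.ext ?_
  filter_upwards [coeFn_mulLp (normalizedSymbol m R) (smulVec w g),
    Lp.coeFn_add (smulVec w (𝓕 v)) (smulVec (R w) (𝓕 v')), coeFn_smulVec w (𝓕 v),
    coeFn_smulVec (R w) (𝓕 v'), coeFn_smulVec w g, hv, hv'] with x h1 h2 h3 h4 h5 h6 h7
  rw [h2, Pi.add_apply, h3, h4, h1, h5, h6, h7, map_smul, normalizedSymbol_apply]
  have h8 : ((1 + laplaceSymbol x)⁻¹ • (1 + laplaceSymbol x • R)) w =
      (((1 + laplaceSymbol x)⁻¹ : ℝ) : ℂ) • (w + ((laplaceSymbol x : ℝ) : ℂ) • R w) := by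
    rw [Complex.coe_smul, Complex.coe_smul]; rfl
  rw [h8]
  push_cast
  module

/-- The algebraic range contains the image of a dense space under a multiplication operator with
dense range. This is what makes the closure maximal. -/
theorem dense_range_algTensorSumGraph (h : IsBoundedInverse L R) (hR : IsSelfAdjoint R)
    (hspec : spectrum ℝ R ⊆ Set.Icc 0 l⁻¹) :
    Dense (((algTensorSumGraph L (negLaplacian m)).map (LinearMap.snd ℂ _ _) :
      Submodule ℂ (HilbertTensor H (L2 m))) : Set (HilbertTensor H (L2 m))) := by
  set W := (algTensorSumGraph L (negLaplacian m)).map (LinearMap.snd ℂ _ _) with hW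
  have hd : DenseRange (mulLp (volume : Measure (EuclideanSpace ℝ (Fin m)))
      (normalizedSymbol m R) ∘ tensorToLp H volume) :=
    (denseRange_mulLp (isSelfAdjoint_normalizedSymbol hR)
      (normalizedSymbol_injective hR hspec)).comp denseRange_tensorToLp (map_continuous _)
  have hd2 := (partialFourier H m).symm.surjective.denseRange.comp hd
    (partialFourier H m).symm.continuous
  refine hd2.mono ?_
  rintro _ ⟨t, rfl⟩
  induction t with
  | zero => simp
  | add a b ha hb =>
    simp only [Function.comp_apply, map_add] at ha hb ⊢
    exact add_mem ha hb
  | tmul w g =>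
    obtain ⟨u, v, huv⟩ := mulLp_normalizedSymbol_smulVec_mem h w g
    rw [Function.comp_apply, Function.comp_apply, tensorToLp_tmul, ← huv,
      LinearIsometryEquiv.symm_apply_apply]
    exact ⟨_, Submodule.subset_span ⟨(u, v), rfl⟩, rfl⟩

/-- The pairs `(T y, y)` form a closed set containing the algebraic graph. Conversely, they lie in
that graph for a dense set of `y`, and `y ↦ (T y, y)` is continuous. -/
theorem mem_topologicalClosure_algTensorSumGraph_iff (h : IsBoundedInverse L R)
    (hR : IsSelfAdjoint R) (hspec : spectrum ℝ R ⊆ Set.Icc 0 l⁻¹) (hl : 0 < l)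
    (p : HilbertTensor H (L2 m) × HilbertTensor H (L2 m)) :
    p ∈ (algTensorSumGraph L (negLaplacian m)).topologicalClosure ↔
      momentumMultiplier H m (resolventSymbol m hspec hl) p.2 = p.1 := by
  set T := momentumMultiplier H m (resolventSymbol m hspec hl) with hT
  have hle : ∀ p ∈ algTensorSumGraph L (negLaplacian m), T p.2 = p.1 := by
    intro p hp
    refine Submodule.span_induction ?_ ?_ ?_ ?_ hp
    · rintro _ ⟨⟨u, v⟩, rfl⟩
      exact momentumMultiplier_resolventSymbol_apply h hR hspec hl u v
    · simp
    · intro x y _ _ hx hy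
      rw [Prod.snd_add, Prod.fst_add, map_add, hx, hy]
    · intro c x _ hx
      rw [Prod.smul_snd, Prod.smul_fst, map_smul, hx]
  have hc : Continuous T := T.continuous
  constructor
  · intro hp
    rw [← SetLike.mem_coe, Submodule.topologicalClosure_coe] at hp
    exact closure_minimal hle (isClosed_eq (hc.comp continuous_snd) continuous_fst) hp
  · intro hp
    have hy := dense_range_algTensorSumGraph (m := m) h hR hspec p.2
    have := map_mem_closure (f := fun y => (T y, y)) (by fun_prop) hy
      (t := (algTensorSumGraph L (negLaplacian m) : Set _)) (by
        rintro _ ⟨q, hq, rfl⟩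
        have : (T q.2, q.2) = q := Prod.ext (hle q hq) rfl
        change (T q.2, q.2) ∈ _
        rw [this]; exact hq)
    rw [hp] at this
    rw [← SetLike.mem_coe, Submodule.topologicalClosure_coe]
    exact this

theorem shiftedInv_injective (h : IsBoundedInverse L R) (hR : IsSelfAdjoint R)
    (hspec : spectrum ℝ R ⊆ Set.Icc 0 l⁻¹) {c : ℝ} (hc : 0 ≤ c) (y : H)
    (hy : shiftedInv R c y = 0) : y = 0 := by
  obtain ⟨x, hx, hxy⟩ := (h.shift hR hspec hc).2 y
  rw [← hxy, show x = 0 from Subtype.ext (hx.trans hy), LinearPMap.map_zero]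

/-- Injectivity of the multiplier makes the closed relation single-valued, so the closure really is
the graph of `ambientOperator`. -/
theorem isBoundedInverse_ambientOperator (h : IsBoundedInverse L R)
    (hR : IsSelfAdjoint R) (hspec : spectrum ℝ R ⊆ Set.Icc 0 l⁻¹) (hl : 0 < l) :
    IsBoundedInverse (ambientOperator L m)
      (momentumMultiplier H m (resolventSymbol m hspec hl)) := by
  have hg : (ambientOperator L m).graph =
      (algTensorSumGraph L (negLaplacian m)).topologicalClosure := by
    refine Submodule.toLinearPMap_graph_eq _ fun p hp hp0 => ?_
    rw [mem_topologicalClosure_algTensorSumGraph_iff h hR hspec hl, hp0] at hp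
    have h0 : mulLp volume (resolventSymbol m hspec hl) (partialFourier H m p.2) = 0 := by
      rw [← partialFourier_momentumMultiplier, hp, map_zero]
    have h1 : partialFourier H m p.2 = 0 := mulLp_eq_zero (fun x y hy =>
      shiftedInv_injective h hR hspec (laplaceSymbol_nonneg x) y hy) h0
    exact (LinearIsometryEquiv.map_eq_zero_iff _).mp h1
  have hiff := mem_topologicalClosure_algTensorSumGraph_iff (m := m) h hR hspec hl
  rw [← hg] at hiff
  refine ⟨fun x => (hiff _).mp ((ambientOperator L m).mem_graph x), fun y => ?_⟩
  obtain ⟨x, hx, hxy⟩ := (LinearPMap.mem_graph_iff _).mp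
    ((hiff (momentumMultiplier H m (resolventSymbol m hspec hl) y, y)).mpr rfl)
  exact ⟨x, hx, hxy⟩

/-- For `x = (L + c)⁻¹ y` one has `Re ⟨x, y⟩ = c ‖x‖² + Re ⟨x, L x⟩`. Stated through the inverse,
the bound can be integrated over momenta. -/
theorem re_inner_shiftedInv (h : IsBoundedInverse L R) (hR : IsSelfAdjoint R)
    (hspec : spectrum ℝ R ⊆ Set.Icc 0 l⁻¹) (hLl : BoundedBelowBy L l) {c : ℝ} (hc : 0 ≤ c)
    (y : H) : l * ‖shiftedInv R c y‖ ^ 2 ≤ (inner ℂ (shiftedInv R c y) y).re := by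
  obtain ⟨x, hx, hxy⟩ := (h.shift hR hspec hc).2 y
  change L.domain at x
  have h1 := hLl x
  have h2 : (inner ℂ (x : H) y).re = c * ‖(x : H)‖ ^ 2 + (inner ℂ (x : H) (L x)).re := by
    rw [← hxy, shift_apply, inner_add_right, inner_smul_right, Complex.add_re,
      Complex.re_ofReal_mul, inner_self_eq_norm_sq_to_K]
    norm_cast
  rw [← hx]
  rw [h2]
  nlinarith [mul_nonneg hc (sq_nonneg ‖(x : H)‖)]

theorem re_inner_nonneg_of_ae {X : Type*} [MeasurableSpace X] {μ : Measure X} {f g : Lp H 2 μ}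
    (hfg : ∀ᵐ x ∂μ, 0 ≤ (inner ℂ (f x) (g x)).re) : 0 ≤ (inner ℂ f g).re := by
  rw [L2.inner_def]
  have h := integral_re (L2.integrable_inner (𝕜 := ℂ) f g)
  exact (integral_nonneg_of_ae hfg).trans_eq h

theorem boundedBelowBy_ambientOperator (h : IsBoundedInverse L R)
    (hR : IsSelfAdjoint R) (hspec : spectrum ℝ R ⊆ Set.Icc 0 l⁻¹) (hl : 0 < l)
    (hLl : BoundedBelowBy L l) : BoundedBelowBy (ambientOperator L m) l := by
  intro x
  have hx := (isBoundedInverse_ambientOperator (m := m) h hR hspec hl).1 x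
  set y := ambientOperator L m x
  rw [← (partialFourier H m).norm_map, ← (partialFourier H m).inner_map_map, ← hx,
    partialFourier_momentumMultiplier]
  set g := partialFourier H m y
  set f := mulLp volume (resolventSymbol m hspec hl) g with hf
  have key : 0 ≤ (inner ℂ f (g - (l : ℂ) • f)).re := by
    refine re_inner_nonneg_of_ae ?_
    filter_upwards [coeFn_mulLp (resolventSymbol m hspec hl) g, Lp.coeFn_sub g ((l : ℂ) • f),
      Lp.coeFn_smul (l : ℂ) f] with ξ h1 h2 h3
    have h4 := re_inner_shiftedInv h hR hspec hLl (laplaceSymbol_nonneg ξ) (g ξ)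
    rw [h2, Pi.sub_apply, h3, Pi.smul_apply, inner_sub_right, inner_smul_right,
      inner_self_eq_norm_sq_to_K, Complex.sub_re, h1, resolventSymbol_apply]
    norm_cast
    rw [Complex.re_ofReal_mul]
    exact sub_nonneg.mpr h4
  rw [inner_sub_right, inner_smul_right, Complex.sub_re, Complex.re_ofReal_mul,
    inner_self_eq_norm_sq_to_K] at key
  norm_cast at key
  exact sub_nonneg.mp key

end Ambient


/-! ### Fourier transforms of scaled mollifiers -/

section MollifierFourier

open FourierTransform

variable {m : ℕ} (η : Mollifier m)

/-- A mollifier as a Schwartz function. -/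
noncomputable def Mollifier.toSchwartz : 𝓢(EuclideanSpace ℝ (Fin m), ℂ) :=
  η.hasCompactSupport.toSchwartzMap η.contDiff

theorem Mollifier.coe_toSchwartz : (η.toSchwartz : EuclideanSpace ℝ (Fin m) → ℂ) = η.toFun := rfl

theorem Mollifier.fourier_zero : (𝓕 η.toSchwartz) 0 = 1 := by
  rw [SchwartzMap.fourier_coe, Real.fourier_eq]
  simp [η.coe_toSchwartz, η.integral_eq_one]

theorem Mollifier.norm_fourier_le (x : EuclideanSpace ℝ (Fin m)) :
    ‖(𝓕 η.toSchwartz) x‖ ≤ ∫ y, ‖η.toFun y‖ :=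
  VectorFourier.norm_fourierIntegral_le_integral_norm _ _ _ _ _

theorem Mollifier.contDiff_scaled (ε : ℝ) : ContDiff ℝ ∞ (η.scaled ε) := by
  unfold Mollifier.scaled
  exact contDiff_const.mul (η.contDiff.comp (contDiff_const_smul _))

theorem Mollifier.hasCompactSupport_scaled {ε : ℝ} (hε : ε ≠ 0) :
    HasCompactSupport (η.scaled ε) :=
  (η.hasCompactSupport.comp_smul (inv_ne_zero hε)).mul_left

theorem Mollifier.fourier_scaled {ε : ℝ} (hε : 0 < ε) (x : EuclideanSpace ℝ (Fin m)) :
    𝓕 (η.scaled ε) x = (𝓕 η.toSchwartz) (ε • x) := by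
  rw [SchwartzMap.fourier_coe, Real.fourier_eq, Real.fourier_eq, η.coe_toSchwartz]
  have h := Measure.integral_comp_inv_smul (volume : Measure (EuclideanSpace ℝ (Fin m)))
    (fun v => Real.fourierChar (-inner ℝ v (ε • x)) • η.toFun v) ε
  rw [finrank_euclideanSpace_fin, abs_of_pos (by positivity)] at h
  have h2 : ∀ v, Real.fourierChar (-inner ℝ v x) • η.scaled ε v = (ε ^ m)⁻¹ •
      (Real.fourierChar (-inner ℝ (ε⁻¹ • v) (ε • x)) • η.toFun (ε⁻¹ • v)) := by
    intro v
    rw [real_inner_smul_left, real_inner_smul_right, inv_mul_cancel_left₀ hε.ne',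
      Mollifier.scaled, smul_comm, Complex.real_smul]
  simp_rw [h2]
  rw [integral_smul, h, smul_smul, inv_mul_cancel₀ (by positivity), one_smul]

theorem Mollifier.fourier_toLp_scaled {ε : ℝ} (hε : 0 < ε) :
    ∀ᵐ x, (𝓕 ((η.memLp_scaled ε).toLp (η.scaled ε)) : L2 m) x =
      (𝓕 η.toSchwartz) (ε • x) := by
  let S : 𝓢(EuclideanSpace ℝ (Fin m), ℂ) :=
    (η.hasCompactSupport_scaled hε.ne').toSchwartzMap (η.contDiff_scaled ε)
  have h1 : (η.memLp_scaled ε).toLp (η.scaled ε) = S.toLp 2 volume := rfl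
  rw [h1, SchwartzMap.toLp_fourier_eq]
  filter_upwards [(𝓕 S).coeFn_toLp 2 volume] with x hx
  rw [hx, SchwartzMap.fourier_coe]
  exact η.fourier_scaled hε x

end MollifierFourier

/-! ### Integrability and the limit `ε → 0⁺` -/

section Limit

open FourierTransform

variable {H : Type*} [NormedAddCommGroup H] [InnerProductSpace ℂ H] [CompleteSpace H] {m : ℕ}
  {L : H →ₗ.[ℂ] H} {R : H →L[ℂ] H} {l s : ℝ}

/-- Comparison with `(1 + ‖q‖²)⁻ˢ`, through `l + ‖q‖² ≥ min l 1 * (1 + ‖q‖²)`. -/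
theorem integrable_rpow_neg_add_norm_sq (hl : 0 < l) (hs : (m : ℝ) / 2 < s) :
    Integrable fun q : EuclideanSpace ℝ (Fin m) => (l + ‖q‖ ^ 2) ^ (-s) := by
  have h := integrable_rpow_neg_one_add_norm_sq (E := EuclideanSpace ℝ (Fin m)) (r := 2 * s)
    (μ := volume) (by rw [finrank_euclideanSpace_fin]; linarith)
  have hs0 : 0 ≤ s := le_trans (by positivity) hs.le
  refine (h.const_mul ((min l 1) ^ (-s))).mono' ?_ (Eventually.of_forall fun q => ?_)
  · refine (Continuous.rpow_const (by fun_prop) fun q => Or.inl ?_).aestronglyMeasurable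
    positivity
  · have hm : 0 < min l 1 := lt_min hl one_pos
    rw [Real.norm_of_nonneg (by positivity), show -(2 * s) / 2 = -s by ring,
      ← Real.mul_rpow hm.le (by positivity)]
    refine Real.rpow_le_rpow_of_nonpos (by positivity) ?_ (by linarith)
    rw [mul_add, mul_one]
    gcongr
    · exact min_le_left _ _
    · exact mul_le_of_le_one_left (by positivity) (min_le_right _ _)

theorem continuous_negPow_shift (h : IsBoundedInverse L R) (hR : IsSelfAdjoint R)
    (hspec : spectrum ℝ R ⊆ Set.Icc 0 l⁻¹) (hs : 0 ≤ s) :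
    Continuous fun q : EuclideanSpace ℝ (Fin m) => negPow (shift L (‖q‖ ^ 2)) s := by
  have h1 := (continuousOn_cfc_rpow_shifted hspec hs).comp_continuous
    (f := fun q : EuclideanSpace ℝ (Fin m) => ‖q‖ ^ 2) (by fun_prop) fun q => sq_nonneg ‖q‖
  refine h1.congr fun q => ?_
  rw [negPow_shift_eq_cfc h hR hspec (sq_nonneg _) hs]
  rfl

theorem norm_negPow_shift_le (h : IsBoundedInverse L R) (hR : IsSelfAdjoint R)
    (hspec : spectrum ℝ R ⊆ Set.Icc 0 l⁻¹) (hl : 0 < l) (hs : 0 ≤ s) {c : ℝ} (hc : 0 ≤ c) :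
    ‖negPow (shift L c) s‖ ≤ (l + c) ^ (-s) := by
  rw [negPow_shift_eq_cfc h hR hspec hc hs]
  exact norm_cfc_rpow_shifted_le hspec hl hc hs

theorem integrable_negPow_shift (h : IsBoundedInverse L R) (hR : IsSelfAdjoint R)
    (hspec : spectrum ℝ R ⊆ Set.Icc 0 l⁻¹) (hl : 0 < l) (hs : (m : ℝ) / 2 < s) :
    Integrable fun q : EuclideanSpace ℝ (Fin m) => negPow (shift L (‖q‖ ^ 2)) s := by
  have hs0 : 0 ≤ s := le_trans (by positivity) hs.le
  exact (integrable_rpow_neg_add_norm_sq hl hs).mono'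
    (continuous_negPow_shift h hR hspec hs0).aestronglyMeasurable
    (Eventually.of_forall fun q => norm_negPow_shift_le h hR hspec hl hs0 (sq_nonneg _))

theorem laplaceSymbol_eq (x : EuclideanSpace ℝ (Fin m)) :
    laplaceSymbol x = ‖(2 * Real.pi) • x‖ ^ 2 := by
  rw [norm_smul, mul_pow, Real.norm_of_nonneg (by positivity), laplaceSymbol]

/-- The substitution `q = 2πξ` absorbs `(2π)⁻ᵐ` into the Jacobian. -/
theorem inner_transverseOperator (h : IsBoundedInverse L R) (hR : IsSelfAdjoint R)
    (hspec : spectrum ℝ R ⊆ Set.Icc 0 l⁻¹) (hl : 0 < l) (hs : (m : ℝ) / 2 < s) (J K : H) :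
    inner ℂ J (transverseOperator L m s K) =
      ∫ x : EuclideanSpace ℝ (Fin m), inner ℂ J (negPow (shift L (laplaceSymbol x)) s K) := by
  have hi := integrable_negPow_shift (m := m) h hR hspec hl hs
  have h1 : transverseOperator L m s = ∫ x : EuclideanSpace ℝ (Fin m),
      negPow (shift L (laplaceSymbol x)) s := by
    simp_rw [laplaceSymbol_eq]
    rw [Measure.integral_comp_smul volume (fun q : EuclideanSpace ℝ (Fin m) =>
      negPow (shift L (‖q‖ ^ 2)) s), finrank_euclideanSpace_fin, abs_of_pos (by positivity),
      ← integral_smul]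
    rfl
  have hi2 : Integrable fun x : EuclideanSpace ℝ (Fin m) =>
      negPow (shift L (laplaceSymbol x)) s := by
    simp_rw [laplaceSymbol_eq]
    exact hi.comp_smul (by positivity)
  rw [h1, ContinuousLinearMap.integral_apply hi2, integral_inner]
  exact hi2.apply_continuousLinearMap K

theorem inner_smearedSource (η : Mollifier m) {ε : ℝ} (hε : 0 < ε) (J K : H)
    (G : EuclideanSpace ℝ (Fin m) →ᵇ (H →L[ℂ] H)) :
    inner ℂ (smearedSource η ε J) (momentumMultiplier H m G (smearedSource η ε K)) =
      ∫ x, ((‖(𝓕 η.toSchwartz) (ε • x)‖ ^ 2 : ℝ) : ℂ) * inner ℂ J (G x K) := by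
  rw [← (partialFourier H m).inner_map_map, partialFourier_momentumMultiplier, smearedSource,
    smearedSource, partialFourier_pureTensor, partialFourier_pureTensor, L2.inner_def]
  set f : L2 m := 𝓕 ((η.memLp_scaled ε).toLp (η.scaled ε))
  refine integral_congr_ae ?_
  filter_upwards [coeFn_smulVec J f, coeFn_smulVec K f, coeFn_mulLp G (smulVec K f),
    η.fourier_toLp_scaled hε] with x h1 h2 h3 h4
  rw [h1, h3, h2, h4, ContinuousLinearMap.map_smul, inner_smul_left, inner_smul_right, ← mul_assoc,
    Complex.conj_mul']
  push_cast
  rfl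

theorem tendsto_inner_smearedSource (h : IsBoundedInverse L R) (hR : IsSelfAdjoint R)
    (hspec : spectrum ℝ R ⊆ Set.Icc 0 l⁻¹) (hl : 0 < l) (hs : (m : ℝ) / 2 < s)
    (η : Mollifier m) (J K : H) :
    Tendsto (fun ε : ℝ => inner ℂ (smearedSource η ε J)
        (negPow (ambientOperator L m) s (smearedSource η ε K)))
      (𝓝[>] 0) (𝓝 (inner ℂ J (transverseOperator L m s K))) := by
  have hs0 : 0 ≤ s := le_trans (by positivity) hs.le
  -- `G` is the symbol of `L_M⁻ˢ`, with pointwise values `(L + |2πξ|²)⁻ˢ`.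
  obtain ⟨G, hG, hGx⟩ := exists_cfc_mulLp
    (B := HilbertTensor H (L2 m) →L[ℂ] HilbertTensor H (L2 m)) (momentumMultiplier H m)
    (resolventSymbol m hspec hl)
    (isSelfAdjoint_resolventSymbol hspec hl) (Real.continuous_rpow_const hs0)
  have hGx' : ∀ x, G x = negPow (shift L (laplaceSymbol x)) s := fun x => by
    rw [hGx, resolventSymbol_apply, negPow_eq_cfc (h.shift hR hspec (laplaceSymbol_nonneg x))]
  rw [negPow_eq_cfc (isBoundedInverse_ambientOperator h hR hspec hl), ← hG,
    inner_transverseOperator h hR hspec hl hs]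
  simp_rw [← hGx']
  have hcongr : (fun ε : ℝ => ∫ x, ((‖(𝓕 η.toSchwartz) (ε • x)‖ ^ 2 : ℝ) : ℂ) *
      inner ℂ J (G x K)) =ᶠ[𝓝[>] 0] fun ε : ℝ => inner ℂ (smearedSource η ε J)
        (momentumMultiplier H m G (smearedSource η ε K)) := by
    filter_upwards [self_mem_nhdsWithin] with ε hε
    exact (inner_smearedSource η hε J K G).symm
  refine Tendsto.congr' hcongr ?_
  have hGc : Continuous fun x => (inner ℂ J (G x K) : ℂ) := by
    have := G.continuous
    fun_prop
  have hFc : Continuous (𝓕 η.toSchwartz : 𝓢(EuclideanSpace ℝ (Fin m), ℂ)) :=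
    (𝓕 η.toSchwartz).continuous
  refine tendsto_integral_filter_of_dominated_convergence
    -- The `L¹` norm of `η` bounds its Fourier transform, uniformly in `ε`.
    (fun x => (∫ y, ‖η.toFun y‖) ^ 2 * (‖J‖ * ((l + ‖(2 * Real.pi) • x‖ ^ 2) ^ (-s) * ‖K‖)))
    ?_ ?_ ?_ ?_
  · refine Eventually.of_forall fun ε => Continuous.aestronglyMeasurable ?_
    fun_prop
  · refine Eventually.of_forall fun ε => Eventually.of_forall fun x => ?_
    rw [norm_mul, Complex.norm_real, Real.norm_of_nonneg (by positivity)]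
    gcongr
    · exact η.norm_fourier_le _
    · refine (norm_inner_le_norm _ _).trans ?_
      gcongr
      refine ((G x).le_opNorm K).trans ?_
      gcongr
      rw [hGx', ← laplaceSymbol_eq]
      exact norm_negPow_shift_le h hR hspec hl hs0 (laplaceSymbol_nonneg x)
  · have hi := (integrable_rpow_neg_add_norm_sq hl hs).comp_smul
      (R := 2 * Real.pi) (by positivity)
    exact ((hi.mul_const ‖K‖).const_mul ‖J‖).const_mul _
  · refine Eventually.of_forall fun x => ?_
    have h1 : Tendsto (fun ε : ℝ => ((‖(𝓕 η.toSchwartz) (ε • x)‖ ^ 2 : ℝ) : ℂ) *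
        inner ℂ J (G x K)) (𝓝 0)
        (𝓝 (((‖(𝓕 η.toSchwartz) ((0 : ℝ) • x)‖ ^ 2 : ℝ) : ℂ) * inner ℂ J (G x K))) := by
      refine Continuous.tendsto ?_ 0
      fun_prop
    rw [zero_smul, η.fourier_zero, norm_one, one_pow, Complex.ofReal_one, one_mul] at h1
    exact h1.mono_left nhdsWithin_le_nhds

end Limit

end TransverseRestriction

theorem mainTheorem3 {H : Type*} [NormedAddCommGroup H] [InnerProductSpace ℂ H] [CompleteSpace H]
    (L : H →ₗ.[ℂ] H) (hL : IsSelfAdjoint L) (l : ℝ) (hl : 0 < l)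
    (hLl : TransverseRestriction.BoundedBelowBy L l)
    (m : ℕ) (hm : 1 ≤ m) (s : ℝ) (hs : (m : ℝ) / 2 < s) :
    (IsSelfAdjoint (TransverseRestriction.ambientOperator L m) ∧
      TransverseRestriction.BoundedBelowBy (TransverseRestriction.ambientOperator L m) l) ∧
    Integrable (TransverseRestriction.transverseIntegrand L m s) ∧
    ∀ (η : TransverseRestriction.Mollifier m) (J K : H),
      Tendsto (fun ε : ℝ =>
          inner ℂ (TransverseRestriction.smearedSource η ε J)
            (TransverseRestriction.negPow (TransverseRestriction.ambientOperator L m) s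
              (TransverseRestriction.smearedSource η ε K)))
        (𝓝[>] 0)
        (𝓝 (inner ℂ J (TransverseRestriction.transverseOperator L m s K))) := by
  obtain ⟨R, h, hR, hspec⟩ := TransverseRestriction.exists_isBoundedInverse hL hl hLl
  have hA := TransverseRestriction.isBoundedInverse_ambientOperator (m := m) h hR hspec hl
  refine ⟨⟨hA.isSelfAdjoint ?_, ?_⟩, ?_, fun η J K => ?_⟩
  · exact (TransverseRestriction.isSelfAdjoint_resolventSymbol hspec hl).map
      (TransverseRestriction.momentumMultiplier H m)
  · exact TransverseRestriction.boundedBelowBy_ambientOperator h hR hspec hl hLl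
  · exact (TransverseRestriction.integrable_negPow_shift h hR hspec hl hs).smul
      (((2 * Real.pi) ^ m)⁻¹ : ℝ)
  · exact TransverseRestriction.tendsto_inner_smearedSource h hR hspec hl hs η J K
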